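/- Let $n\ge 1$ be an integer and let $F_n\in\mathbb{R}[x,t]$ be a polynomial of the form $F_n(x,t)=(x^2+t^2)^{n(n+1)/2}+G_n(x,t)$, where $G_n$ is a real polynomial of total degree less than $n(n+1)$, such that $F_n(x,t)\neq 0$ for all real $x,t$. Suppose that the (algebraically decaying) rational function $$u_n(x,t)=2\,\frac{\partial^2}{\partial x^2}\ln F_n(x,t)$$ is a solution on $\mathbb{R}^2$ of the Boussinesq equation $$u_{tt}+u_{xx}-(u^2)_{xx}-\tfrac13u_{xxxx}=0.$$ Then $u_n^2$ and $u_n^3$ are integrable over $\mathbb{R}^2$, and $$\frac1{8\pi}\int_{-\infty}^{\infty}\int_{-\infty}^{\infty}u_n^2(x,t)\,dx\,dt=\tfrac12n(n+1),\qquad \frac1{8\pi}\int_{-\infty}^{\infty}\int_{-\infty}^{\infty}u_n^3(x,t)\,dx\,dt=n(n+1).$$ -/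

import Mathlib

open MeasureTheory

/-- The value at the real point `(x, t)` of a real polynomial in two variables;
variable `0` is `x`, variable `1` is `t`. -/
noncomputable def evalXT (P : MvPolynomial (Fin 2) ℝ) (x t : ℝ) : ℝ :=
  MvPolynomial.eval ![x, t] P

/-- `u : (x, t) ↦ u x t` is a classical solution on the whole plane of the Boussinesq equation
`u_tt + u_xx - (u²)_xx - (1/3) u_xxxx = 0`. -/
def IsBoussinesqSolution (u : ℝ → ℝ → ℝ) : Prop :=
  ContDiff ℝ 4 (fun p : ℝ × ℝ => u p.1 p.2) ∧
  ∀ x t : ℝ,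
    iteratedDeriv 2 (fun s => u x s) t + iteratedDeriv 2 (fun y => u y t) x
      - iteratedDeriv 2 (fun y => u y t ^ 2) x
      - (1 / 3 : ℝ) * iteratedDeriv 4 (fun y => u y t) x = 0

/-- The function `2 ∂²/∂x² ln F(x, t)` attached to a real polynomial `F` in `x` and `t`. -/
noncomputable def twoLogXX (F : MvPolynomial (Fin 2) ℝ) (x t : ℝ) : ℝ :=
  2 * iteratedDeriv 2 (fun y => Real.log (evalXT F y t)) x

open Filter Topology

/-! ### Partial derivatives of polynomials -/

/-! Put m = n(n+1)/2, a = 2 ∂ₓ ln F and b = 2 ∂ₜ ln F, so that u = aₓ and bₓ = aₜ. The Boussinesq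
equation is an exact second x-derivative. Each x-integration produces a function constant in x, and
decay forces it to vanish (`Decays.eq_zero_of_hasDerivAt_fst`). The first gives a_tt + a_xx - (aₓ²)ₓ
- a_xxxx/3 = 0, the second u² = (a - a_xx/3)ₓ + bₜ.

Hence ∫ u² is the limiting flux of (a, b) through large squares, the a_xx term being negligible.
Since (a, b) is 4m (x, t)/(x² + t²) up to O(1/(x² + t²)), that flux is 8πm
(`tendsto_boundary_integral_logDeriv₂`). For the cube, a Pohozaev-type multiplier applied to the
once-integrated equation gives ∫ u³ = 2 ∫ u² (`integral_cube_sub_two_mul_sq_eq_zero`).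

All decay comes from counting degrees of rational functions p / F ^ k, given that F is bounded below
by a multiple of its expected growth (`exists_mul_one_add_norm_pow_le`, `RatOrder.decays`); each
derivative gains one order (`RatOrder.ratDeriv`). `integral_sq_and_cube_of_boussinesq` assembles
these facts. -/

theorem MvPolynomial.pderiv_comm {σ R : Type*} [CommRing R] (i j : σ) (p : MvPolynomial σ R) :
    MvPolynomial.pderiv i (MvPolynomial.pderiv j p) =
      MvPolynomial.pderiv j (MvPolynomial.pderiv i p) := by
  classical
  have h : ⁅MvPolynomial.pderiv (R := R) i, MvPolynomial.pderiv (R := R) j⁆ = 0 := by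
    apply MvPolynomial.derivation_ext
    intro k
    rw [Derivation.commutator_apply]
    by_cases hi : k = i <;> by_cases hj : k = j <;>
      simp [MvPolynomial.pderiv_X, Pi.single_apply, hi, hj, apply_ite]
  have := congrArg (fun D : Derivation R (MvPolynomial σ R) (MvPolynomial σ R) => D p) h
  simpa [Derivation.commutator_apply, sub_eq_zero] using this

theorem MvPolynomial.pderiv_eq_zero_of_totalDegree_eq_zero {σ R : Type*} [CommRing R] (i : σ)
    {p : MvPolynomial σ R} (hp : p.totalDegree = 0) : MvPolynomial.pderiv i p = 0 := by
  rw [MvPolynomial.totalDegree_eq_zero_iff_eq_C.1 hp, MvPolynomial.pderiv_C]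

theorem MvPolynomial.totalDegree_pderiv_le {σ R : Type*} [CommRing R] (i : σ)
    (p : MvPolynomial σ R) :
    (MvPolynomial.pderiv i p).totalDegree ≤ p.totalDegree - 1 := by
  refine Finset.sup_le fun m hm => ?_
  have hc : p.coeff (m + Finsupp.single i 1) ≠ 0 := by
    intro h
    rw [MvPolynomial.mem_support_iff, MvPolynomial.coeff_pderiv, h] at hm
    simp at hm
  have := MvPolynomial.le_totalDegree (MvPolynomial.mem_support_iff.2 hc)
  rw [Finsupp.sum_add_index' (by simp) (by simp), Finsupp.sum_single_index rfl] at this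
  omega

theorem hasDerivAt_evalXT_fst (p : MvPolynomial (Fin 2) ℝ) (x t : ℝ) :
    HasDerivAt (fun y => evalXT p y t) (evalXT (MvPolynomial.pderiv 0 p) x t) x := by
  induction p using MvPolynomial.induction_on with
  | C a => simpa [evalXT] using hasDerivAt_const x a
  | add p q hp hq => simpa [evalXT] using hp.fun_add hq
  | mul_X p i hp =>
    have hX : HasDerivAt (fun y => evalXT (MvPolynomial.X i) y t)
        (evalXT (MvPolynomial.pderiv 0 (MvPolynomial.X i)) x t) x := by
      fin_cases i
      · simpa [evalXT] using hasDerivAt_id' x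
      · simpa [evalXT, MvPolynomial.pderiv_X] using hasDerivAt_const x t
    have := hp.mul hX
    simp only [evalXT, MvPolynomial.pderiv_mul, map_mul, map_add] at this ⊢
    exact this

theorem hasDerivAt_evalXT_snd (p : MvPolynomial (Fin 2) ℝ) (x t : ℝ) :
    HasDerivAt (fun s => evalXT p x s) (evalXT (MvPolynomial.pderiv 1 p) x t) t := by
  induction p using MvPolynomial.induction_on with
  | C a => simpa [evalXT] using hasDerivAt_const t a
  | add p q hp hq => simpa [evalXT] using hp.fun_add hq
  | mul_X p i hp =>
    have hX : HasDerivAt (fun y => evalXT (MvPolynomial.X i) x y)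
        (evalXT (MvPolynomial.pderiv 1 (MvPolynomial.X i)) x t) t := by
      fin_cases i
      · simpa [evalXT, MvPolynomial.pderiv_X] using hasDerivAt_const t x
      · simpa [evalXT] using hasDerivAt_id' t
    have := hp.mul hX
    simp only [evalXT, MvPolynomial.pderiv_mul, map_mul, map_add] at this ⊢
    exact this

theorem continuous_evalXT (p : MvPolynomial (Fin 2) ℝ) :
    Continuous fun z : ℝ × ℝ => evalXT p z.1 z.2 := by
  refine (MvPolynomial.continuous_eval p).comp (continuous_pi fun i => ?_)
  fin_cases i
  · exact continuous_fst
  · exact continuous_snd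

/-! ### Decay at infinity -/

/-- `f z = O((1 + ‖z‖) ^ (-d))` on the whole plane. -/
def Decays (d : ℕ) (f : ℝ × ℝ → ℝ) : Prop := ∃ C, ∀ z, |f z| * (1 + ‖z‖) ^ d ≤ C

theorem Decays.add {d : ℕ} {f g : ℝ × ℝ → ℝ} (hf : Decays d f) (hg : Decays d g) :
    Decays d fun z => f z + g z := by
  obtain ⟨A, hA⟩ := hf
  obtain ⟨B, hB⟩ := hg
  refine ⟨A + B, fun z => ?_⟩
  have h : |f z + g z| * (1 + ‖z‖) ^ d ≤ (|f z| + |g z|) * (1 + ‖z‖) ^ d := by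
    gcongr; exact abs_add_le _ _
  linarith [hA z, hB z]

theorem Decays.const_mul {d : ℕ} {f : ℝ × ℝ → ℝ} (hf : Decays d f) (c : ℝ) :
    Decays d fun z => c * f z := by
  obtain ⟨A, hA⟩ := hf
  refine ⟨|c| * A, fun z => ?_⟩
  rw [abs_mul, mul_assoc]
  exact mul_le_mul_of_nonneg_left (hA z) (abs_nonneg c)

theorem Decays.neg {d : ℕ} {f : ℝ × ℝ → ℝ} (hf : Decays d f) : Decays d fun z => -f z := by
  simpa using hf.const_mul (-1)

theorem Decays.sub {d : ℕ} {f g : ℝ × ℝ → ℝ} (hf : Decays d f) (hg : Decays d g) :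
    Decays d fun z => f z - g z := by
  simpa [sub_eq_add_neg] using hf.add hg.neg

theorem Decays.mul {d e : ℕ} {f g : ℝ × ℝ → ℝ} (hf : Decays d f) (hg : Decays e g) :
    Decays (d + e) fun z => f z * g z := by
  obtain ⟨A, hA⟩ := hf
  obtain ⟨B, hB⟩ := hg
  refine ⟨A * B, fun z => ?_⟩
  have h := mul_le_mul (hA z) (hB z) (by positivity) ((by positivity : (0 : ℝ) ≤ _).trans (hA z))
  rw [abs_mul, pow_add]
  linarith

theorem Decays.pow {d : ℕ} {f : ℝ × ℝ → ℝ} (hf : Decays d f) (k : ℕ) :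
    Decays (k * d) fun z => f z ^ k := by
  obtain ⟨A, hA⟩ := hf
  refine ⟨A ^ k, fun z => ?_⟩
  have h := pow_le_pow_left₀ (by positivity) (hA z) k
  rwa [mul_pow, ← abs_pow, ← pow_mul, mul_comm d k] at h

theorem Decays.mono {d e : ℕ} {f : ℝ × ℝ → ℝ} (hf : Decays d f) (h : e ≤ d) : Decays e f := by
  obtain ⟨A, hA⟩ := hf
  refine ⟨A, fun z => le_trans ?_ (hA z)⟩
  have : (1 : ℝ) ≤ 1 + ‖z‖ := by linarith [norm_nonneg z]
  gcongr

theorem Decays.mul_of_abs_le_norm {d : ℕ} {f c : ℝ × ℝ → ℝ} (hf : Decays (d + 1) f)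
    (hc : ∀ z, |c z| ≤ ‖z‖) : Decays d fun z => c z * f z := by
  obtain ⟨A, hA⟩ := hf
  refine ⟨A, fun z => le_trans ?_ (hA z)⟩
  rw [abs_mul, pow_succ]
  have h : |c z| ≤ 1 + ‖z‖ := by linarith [hc z]
  calc |c z| * |f z| * (1 + ‖z‖) ^ d ≤ (1 + ‖z‖) * |f z| * (1 + ‖z‖) ^ d := by gcongr
    _ = _ := by ring

theorem Decays.fst_mul {d : ℕ} {f : ℝ × ℝ → ℝ} (hf : Decays (d + 1) f) :
    Decays d fun z => z.1 * f z :=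
  hf.mul_of_abs_le_norm fun z => norm_fst_le z

theorem Decays.snd_mul {d : ℕ} {f : ℝ × ℝ → ℝ} (hf : Decays (d + 1) f) :
    Decays d fun z => z.2 * f z :=
  hf.mul_of_abs_le_norm fun z => norm_snd_le z

/-- The plane has dimension 2, so 3 is the first integer exponent for which `(1 + ‖z‖) ^ (-d)` is
integrable. -/
theorem Decays.integrable {d : ℕ} {f : ℝ × ℝ → ℝ} (hf : Decays d f) (hd : 3 ≤ d)
    (hc : Continuous f) : Integrable f := by
  obtain ⟨A, hA⟩ := hf.mono hd
  have hI : Integrable (fun z : ℝ × ℝ => (1 + ‖z‖) ^ (-(3 : ℝ))) :=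
    integrable_one_add_norm (by simp; norm_num)
  refine (hI.const_mul A).mono' hc.aestronglyMeasurable (ae_of_all _ fun z => ?_)
  rw [Real.rpow_neg (by positivity), ← div_eq_mul_inv, le_div_iff₀ (by positivity)]
  exact_mod_cast hA z

theorem Decays.eq_zero_of_hasDerivAt_fst {f : ℝ × ℝ → ℝ} (hf : Decays 1 f)
    (h : ∀ x t, HasDerivAt (fun y => f (y, t)) 0 x) (z : ℝ × ℝ) : f z = 0 := by
  obtain ⟨x, t⟩ := z
  obtain ⟨A, hA⟩ := hf
  have hconst : ∀ y, f (x, t) = f (y, t) := fun y =>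
    is_const_of_deriv_eq_zero (fun y => (h y t).differentiableAt) (fun y => (h y t).deriv) x y
  by_contra hne
  have hpos : 0 < |f (x, t)| := abs_pos.2 hne
  -- With v the constant value on the horizontal line, the bound at abscissa A / |v| gives |v| + A ≤
  -- A.
  have h1 := hA (A / |f (x, t)|, t)
  rw [← hconst, pow_one] at h1
  have h2 : A / |f (x, t)| ≤ ‖((A / |f (x, t)|, t) : ℝ × ℝ)‖ :=
    (le_abs_self _).trans (norm_fst_le ((A / |f (x, t)|, t) : ℝ × ℝ))
  have h3 : |f (x, t)| * (A / |f (x, t)|) = A := by field_simp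
  nlinarith

theorem exists_abs_evalXT_le {p : MvPolynomial (Fin 2) ℝ} (d : ℕ) (hp : p.totalDegree ≤ d) :
    ∃ C, ∀ z : ℝ × ℝ, |evalXT p z.1 z.2| ≤ C * (1 + ‖z‖) ^ d := by
  refine ⟨∑ m ∈ p.support, |p.coeff m|, fun z => ?_⟩
  rw [evalXT, MvPolynomial.eval_eq', Finset.sum_mul]
  refine (Finset.abs_sum_le_sum_abs _ _).trans (Finset.sum_le_sum fun m hm => ?_)
  rw [abs_mul]
  gcongr
  have hm' := (MvPolynomial.le_totalDegree hm).trans hp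
  rw [Finsupp.sum_fintype _ _ (by simp), Fin.sum_univ_two] at hm'
  have h1 : |z.1| ≤ 1 + ‖z‖ := by linarith [norm_fst_le z, Real.norm_eq_abs z.1]
  have h2 : |z.2| ≤ 1 + ‖z‖ := by linarith [norm_snd_le z, Real.norm_eq_abs z.2]
  rw [Fin.prod_univ_two, abs_mul, abs_pow, abs_pow]
  calc |z.1| ^ m 0 * |z.2| ^ m 1 ≤ (1 + ‖z‖) ^ m 0 * (1 + ‖z‖) ^ m 1 := by gcongr
    _ = (1 + ‖z‖) ^ (m 0 + m 1) := (pow_add _ _ _).symm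
    _ ≤ _ := pow_le_pow_right₀ (by linarith [norm_nonneg z]) hm'

/-! ### The divergence theorem on the plane -/

/-- Only the sum `P' + Q'` has to be integrable on the plane: the splitting and Fubini take place on
bounded squares, where continuity suffices. This matters for u², whose two divergence terms are only
known to decay to order 2. -/
theorem integral_divergence_eq_of_tendsto {P Q P' Q' : ℝ × ℝ → ℝ}
    (hP : ∀ x t, HasDerivAt (fun y => P (y, t)) (P' (x, t)) x)
    (hQ : ∀ x t, HasDerivAt (fun s => Q (x, s)) (Q' (x, t)) t)
    (hP' : Continuous P') (hQ' : Continuous Q')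
    (hint : Integrable fun z => P' z + Q' z) {L : ℝ}
    (hL : Tendsto (fun R : ℝ => (∫ t in (-R)..R, (P (R, t) - P (-R, t))) +
      ∫ x in (-R)..R, (Q (x, R) - Q (x, -R))) atTop (𝓝 L)) :
    ∫ z, (P' z + Q' z) = L := by
  have hcov : AECover (volume : Measure (ℝ × ℝ)) atTop
      fun R : ℝ => Set.Ioc (-R) R ×ˢ Set.Ioc (-R) R := by
    refine ⟨ae_of_all _ fun z => ?_, fun R => measurableSet_Ioc.prod measurableSet_Ioc⟩
    filter_upwards [eventually_gt_atTop |z.1|, eventually_gt_atTop |z.2|] with R h1 h2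
    exact ⟨⟨(abs_lt.1 h1).1, (abs_lt.1 h1).2.le⟩, ⟨(abs_lt.1 h2).1, (abs_lt.1 h2).2.le⟩⟩
  refine tendsto_nhds_unique (hcov.integral_tendsto_of_countably_generated hint)
    (hL.congr' ?_)
  filter_upwards [eventually_ge_atTop 0] with R hR
  have hR' : -R ≤ R := by linarith
  rw [Measure.volume_eq_prod]
  have hon : ∀ f : ℝ × ℝ → ℝ, Continuous f →
      IntegrableOn f (Set.Ioc (-R) R ×ˢ Set.Ioc (-R) R) (volume.prod volume) := fun f hf =>
    (hf.continuousOn.integrableOn_compact (μ := volume.prod volume)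
      ((isCompact_Icc (a := -R) (b := R)).prod (isCompact_Icc (a := -R) (b := R)))).mono_set
      (Set.prod_mono Set.Ioc_subset_Icc_self Set.Ioc_subset_Icc_self)
  rw [integral_add (hon P' hP') (hon Q' hQ')]
  congr 1
  · have hs : ∫ z in Set.Ioc (-R) R ×ˢ Set.Ioc (-R) R, P' z ∂(volume.prod volume) =
        ∫ t in Set.Ioc (-R) R, ∫ x in Set.Ioc (-R) R, P' (x, t) := by
      have h := hon P' hP'
      rw [IntegrableOn, ← Measure.prod_restrict] at h
      rw [← Measure.prod_restrict, integral_prod_symm _ h]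
    rw [hs, intervalIntegral.integral_of_le hR']
    congr 1
    funext t
    rw [← intervalIntegral.integral_of_le hR']
    refine (intervalIntegral.integral_eq_sub_of_hasDerivAt (fun x _ => hP x t) ?_).symm
    exact (hP'.comp (by fun_prop : Continuous fun x : ℝ => (x, t))).intervalIntegrable _ _
  · have hs : ∫ z in Set.Ioc (-R) R ×ˢ Set.Ioc (-R) R, Q' z ∂(volume.prod volume) =
        ∫ x in Set.Ioc (-R) R, ∫ t in Set.Ioc (-R) R, Q' (x, t) := by
      have h := hon Q' hQ'
      rw [IntegrableOn, ← Measure.prod_restrict] at h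
      rw [← Measure.prod_restrict, integral_prod _ h]
    rw [hs, intervalIntegral.integral_of_le hR']
    congr 1
    funext x
    rw [← intervalIntegral.integral_of_le hR']
    refine (intervalIntegral.integral_eq_sub_of_hasDerivAt (fun t _ => hQ x t) ?_).symm
    exact (hQ'.comp (by fun_prop : Continuous fun t : ℝ => (x, t))).intervalIntegrable _ _

/-- A function bounded by a multiple of `‖z‖ ^ (-2)` has vanishing mean over a side of the square
of radius `R` as `R → ∞`. -/
theorem tendsto_integral_zero_of_abs_mul_sq_le {f : ℝ → ℝ → ℝ} {C : ℝ}
    (h : ∀ R s, 1 ≤ R → |s| ≤ R → |f R s| * R ^ 2 ≤ C) :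
    Tendsto (fun R : ℝ => ∫ s in (-R)..R, f R s) atTop (𝓝 0) := by
  have hlim : Tendsto (fun R : ℝ => 2 * C / R) atTop (𝓝 0) :=
    tendsto_const_nhds.div_atTop tendsto_id
  refine squeeze_zero_norm' ?_ hlim
  filter_upwards [eventually_ge_atTop 1] with R hR
  have hb := intervalIntegral.norm_integral_le_of_norm_le_const (a := -R) (b := R)
    (f := f R) (C := C / R ^ 2) (fun s hs => by
      rw [Set.uIoc_of_le (by linarith)] at hs
      rw [Real.norm_eq_abs, le_div_iff₀ (by positivity)]
      exact h R s hR (abs_le.2 ⟨hs.1.le, hs.2⟩))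
  refine hb.trans (le_of_eq ?_)
  rw [show R - -R = 2 * R by ring, abs_of_pos (by linarith)]
  field_simp

/-- This is the angle that a side of the square subtends at the centre, hence its independence of
`R`. -/
theorem integral_div_sq_add_sq_self {R : ℝ} (hR : 0 < R) :
    ∫ s in (-R)..R, R / (R ^ 2 + s ^ 2) = Real.pi / 2 := by
  rw [integral_div_sq_add_sq, neg_div, div_self hR.ne', Real.arctan_neg, Real.arctan_one]
  ring

/-! ### Rational functions whose denominator is a power of a fixed polynomial

A pair `(p, k)` stands for the rational function `p / F ^ k`. -/

/-- The value of `p / F ^ k`. -/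
noncomputable def ratEval (F : MvPolynomial (Fin 2) ℝ) (q : MvPolynomial (Fin 2) ℝ × ℕ)
    (z : ℝ × ℝ) : ℝ :=
  evalXT q.1 z.1 z.2 / evalXT F z.1 z.2 ^ q.2

/-- The partial derivative of `p / F ^ k`. -/
noncomputable def ratDeriv (F : MvPolynomial (Fin 2) ℝ) (i : Fin 2)
    (q : MvPolynomial (Fin 2) ℝ × ℕ) : MvPolynomial (Fin 2) ℝ × ℕ :=
  (MvPolynomial.pderiv i q.1 * F - MvPolynomial.C (q.2 : ℝ) * (q.1 * MvPolynomial.pderiv i F),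
    q.2 + 1)

variable {F : MvPolynomial (Fin 2) ℝ}

theorem ratDeriv_comm (i j : Fin 2) (q : MvPolynomial (Fin 2) ℝ × ℕ) :
    ratDeriv F i (ratDeriv F j q) = ratDeriv F j (ratDeriv F i q) := by
  simp only [ratDeriv, map_sub, MvPolynomial.pderiv_mul, MvPolynomial.pderiv_C, Nat.cast_add,
    Nat.cast_one, map_add, map_one, MvPolynomial.pderiv_comm i j, Prod.mk.injEq, and_true]
  ring

/-- The logarithmic derivative `2 ∂ᵢF / F`. -/
noncomputable def logDeriv₂ (F : MvPolynomial (Fin 2) ℝ) (i : Fin 2) :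
    MvPolynomial (Fin 2) ℝ × ℕ :=
  (MvPolynomial.C 2 * MvPolynomial.pderiv i F, 1)

theorem ratDeriv_logDeriv₂_comm (i j : Fin 2) :
    ratDeriv F i (logDeriv₂ F j) = ratDeriv F j (logDeriv₂ F i) := by
  simp only [ratDeriv, logDeriv₂, MvPolynomial.pderiv_mul, MvPolynomial.pderiv_C,
    MvPolynomial.pderiv_comm i j, Prod.mk.injEq, and_true]
  ring

theorem hasDerivAt_ratEval_fst (hF : ∀ x t, evalXT F x t ≠ 0) (q : MvPolynomial (Fin 2) ℝ × ℕ)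
    (x t : ℝ) :
    HasDerivAt (fun y => ratEval F q (y, t)) (ratEval F (ratDeriv F 0 q) (x, t)) x := by
  have h := (hasDerivAt_evalXT_fst q.1 x t).fun_div ((hasDerivAt_evalXT_fst F x t).fun_pow q.2)
    (pow_ne_zero _ (hF x t))
  refine h.congr_deriv ?_
  have := hF x t
  simp only [ratEval, ratDeriv, evalXT, map_sub, map_mul, MvPolynomial.eval_C] at this ⊢
  rcases q with ⟨p, k⟩
  cases k with
  | zero => simp; field_simp
  | succ k => simp only [Nat.add_sub_cancel]; field_simp; ring

theorem hasDerivAt_ratEval_snd (hF : ∀ x t, evalXT F x t ≠ 0) (q : MvPolynomial (Fin 2) ℝ × ℕ)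
    (x t : ℝ) :
    HasDerivAt (fun s => ratEval F q (x, s)) (ratEval F (ratDeriv F 1 q) (x, t)) t := by
  have h := (hasDerivAt_evalXT_snd q.1 x t).fun_div ((hasDerivAt_evalXT_snd F x t).fun_pow q.2)
    (pow_ne_zero _ (hF x t))
  refine h.congr_deriv ?_
  have := hF x t
  simp only [ratEval, ratDeriv, evalXT, map_sub, map_mul, MvPolynomial.eval_C] at this ⊢
  rcases q with ⟨p, k⟩
  cases k with
  | zero => simp; field_simp
  | succ k => simp only [Nat.add_sub_cancel]; field_simp; ring

theorem continuous_ratEval (hF : ∀ x t, evalXT F x t ≠ 0) (q : MvPolynomial (Fin 2) ℝ × ℕ) :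
    Continuous (ratEval F q) :=
  (continuous_evalXT q.1).div ((continuous_evalXT F).pow q.2) fun z => pow_ne_zero _ (hF z.1 z.2)

/-- The degree of `p / F ^ k` is at most `-d` when `F` has degree `N`. -/
def RatOrder (N d : ℕ) (q : MvPolynomial (Fin 2) ℝ × ℕ) : Prop := q.1.totalDegree + d ≤ q.2 * N

/-- Both products in the new numerator have degree bound deg p + N - 1, while the denominator gains
a full factor F. -/
theorem RatOrder.ratDeriv {N d : ℕ} {q : MvPolynomial (Fin 2) ℝ × ℕ} (hq : RatOrder N d q)
    (hN : 1 ≤ N) (hFN : F.totalDegree ≤ N) (i : Fin 2) :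
    RatOrder N (d + 1) (ratDeriv F i q) := by
  obtain ⟨p, k⟩ := q
  have hpF := MvPolynomial.totalDegree_pderiv_le i F
  have h2 : (MvPolynomial.C (k : ℝ) * (p * MvPolynomial.pderiv i F)).totalDegree + 1 ≤
      p.totalDegree + N := by
    have := MvPolynomial.totalDegree_mul (MvPolynomial.C (k : ℝ)) (p * MvPolynomial.pderiv i F)
    have := MvPolynomial.totalDegree_mul p (MvPolynomial.pderiv i F)
    simp only [MvPolynomial.totalDegree_C] at *
    omega
  have h1 : (MvPolynomial.pderiv i p * F).totalDegree + 1 ≤ p.totalDegree + N := by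
    -- For constant p the truncated bound `totalDegree - 1` saves nothing; there the derivative is
    -- zero.
    rcases Nat.eq_zero_or_pos p.totalDegree with h | h
    · simp [MvPolynomial.pderiv_eq_zero_of_totalDegree_eq_zero i h]
      omega
    · have := MvPolynomial.totalDegree_mul (MvPolynomial.pderiv i p) F
      have := MvPolynomial.totalDegree_pderiv_le i p
      omega
  have h3 := MvPolynomial.totalDegree_sub (MvPolynomial.pderiv i p * F)
    (MvPolynomial.C (k : ℝ) * (p * MvPolynomial.pderiv i F))
  simp only [RatOrder, _root_.ratDeriv, add_mul] at hq ⊢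
  omega

theorem ratOrder_logDeriv₂ {N : ℕ} (hN : 1 ≤ N) (hFN : F.totalDegree ≤ N) (i : Fin 2) :
    RatOrder N 1 (logDeriv₂ F i) := by
  have h1 := MvPolynomial.totalDegree_mul (MvPolynomial.C (2 : ℝ)) (MvPolynomial.pderiv i F)
  have h2 := MvPolynomial.totalDegree_pderiv_le i F
  simp only [RatOrder, logDeriv₂, MvPolynomial.totalDegree_C] at *
  omega

theorem RatOrder.decays {N d : ℕ} {q : MvPolynomial (Fin 2) ℝ × ℕ} (hq : RatOrder N d q)
    {c : ℝ} (hc : 0 < c) (hF : ∀ z : ℝ × ℝ, c * (1 + ‖z‖) ^ N ≤ |evalXT F z.1 z.2|) :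
    Decays d (ratEval F q) := by
  obtain ⟨C, hC⟩ := exists_abs_evalXT_le (p := q.1) (q.2 * N - d) (by unfold RatOrder at hq; omega)
  refine ⟨C / c ^ q.2, fun z => ?_⟩
  have hF' : 0 < |evalXT F z.1 z.2| := lt_of_lt_of_le (by positivity) (hF z)
  have hρ : 0 < 1 + ‖z‖ := by positivity
  have h1 := pow_le_pow_left₀ (by positivity) (hF z) q.2
  have h2 : (1 + ‖z‖) ^ (q.2 * N - d) * (1 + ‖z‖) ^ d = ((1 + ‖z‖) ^ N) ^ q.2 := by
    rw [← pow_add, ← pow_mul, mul_comm N, Nat.sub_add_cancel (by unfold RatOrder at hq; omega)]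
  have hC0 : 0 ≤ C := by
    by_contra h
    have := (abs_nonneg _).trans (hC z)
    have : 0 < (1 + ‖z‖) ^ (q.2 * N - d) := by positivity
    nlinarith
  rw [ratEval, abs_div, abs_pow, div_mul_eq_mul_div, div_le_div_iff₀ (by positivity) (by positivity)]
  calc |evalXT q.1 z.1 z.2| * (1 + ‖z‖) ^ d * c ^ q.2
      ≤ C * (1 + ‖z‖) ^ (q.2 * N - d) * (1 + ‖z‖) ^ d * c ^ q.2 := by gcongr; exact hC z
    _ = C * (c * (1 + ‖z‖) ^ N) ^ q.2 := by rw [mul_assoc C, h2, mul_pow]; ring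
    _ ≤ _ := by gcongr

/-- A nowhere vanishing polynomial with leading part `(x² + t²) ^ m` is bounded below by a
multiple of `(1 + ‖z‖) ^ (2 * m)`. -/
theorem exists_mul_one_add_norm_pow_le {m : ℕ} {G : MvPolynomial (Fin 2) ℝ}
    (hG : G.totalDegree < 2 * m)
    (hFG : F = (MvPolynomial.X 0 ^ 2 + MvPolynomial.X 1 ^ 2) ^ m + G)
    (hF : ∀ x t, evalXT F x t ≠ 0) :
    ∃ c > 0, ∀ z : ℝ × ℝ, c * (1 + ‖z‖) ^ (2 * m) ≤ |evalXT F z.1 z.2| := by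
  obtain ⟨C, hC⟩ := exists_abs_evalXT_le (p := G) (2 * m - 1) (by omega)
  have heval : ∀ z : ℝ × ℝ, evalXT F z.1 z.2 = (z.1 ^ 2 + z.2 ^ 2) ^ m + evalXT G z.1 z.2 := by
    intro z
    simp [hFG, evalXT]
  have hlead : ∀ z : ℝ × ℝ, ‖z‖ ^ (2 * m) ≤ (z.1 ^ 2 + z.2 ^ 2) ^ m := by
    intro z
    rw [pow_mul]
    refine pow_le_pow_left₀ (by positivity) ?_ m
    rcases max_choice ‖z.1‖ ‖z.2‖ with h | h <;> rw [Prod.norm_def, h, Real.norm_eq_abs, sq_abs]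
    · nlinarith [sq_nonneg z.2]
    · nlinarith [sq_nonneg z.1]
  -- Beyond radius 1, 1 + ‖z‖ ≤ 2‖z‖, so the leading part is at least (1 + ‖z‖)^(2m) / 2^(2m).
  -- Beyond the second threshold |G| is at most half of that. Inside the ball, compactness and
  -- nonvanishing give the bound.
  set R : ℝ := max 1 (C * 2 ^ (2 * m + 1)) with hR
  obtain ⟨z₀, -, hz₀⟩ := (isCompact_closedBall (0 : ℝ × ℝ) R).exists_isMinOn
    (Metric.nonempty_closedBall.2 (by positivity))
    (f := fun z => |evalXT F z.1 z.2| / (1 + ‖z‖) ^ (2 * m))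
    (((continuous_evalXT F).abs.div (by fun_prop) fun z => by positivity).continuousOn)
  refine ⟨min (|evalXT F z₀.1 z₀.2| / (1 + ‖z₀‖) ^ (2 * m)) (1 / 2 ^ (2 * m + 1)), ?_, fun z => ?_⟩
  · have := abs_pos.2 (hF z₀.1 z₀.2)
    exact lt_min (by positivity) (by positivity)
  · have hρ : 0 < 1 + ‖z‖ := by positivity
    rw [← le_div_iff₀ (by positivity)]
    rcases le_or_gt ‖z‖ R with h | h
    · exact (min_le_left _ _).trans (isMinOn_iff.1 hz₀ z (by simpa using h))
    · refine (min_le_right _ _).trans ?_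
      have h1 : 1 ≤ ‖z‖ := (le_max_left _ _).trans h.le
      have h2 : C * 2 ^ (2 * m + 1) ≤ 1 + ‖z‖ := ((le_max_right _ _).trans h.le).trans (by linarith)
      have h3 : (1 + ‖z‖) ^ (2 * m) ≤ 2 ^ (2 * m) * (z.1 ^ 2 + z.2 ^ 2) ^ m := by
        calc (1 + ‖z‖) ^ (2 * m) ≤ (2 * ‖z‖) ^ (2 * m) := by gcongr; linarith
          _ = 2 ^ (2 * m) * ‖z‖ ^ (2 * m) := mul_pow _ _ _
          _ ≤ _ := by gcongr; exact hlead z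
      have h4 : C * (1 + ‖z‖) ^ (2 * m - 1) * 2 ^ (2 * m + 1) ≤ (1 + ‖z‖) ^ (2 * m) := by
        calc C * (1 + ‖z‖) ^ (2 * m - 1) * 2 ^ (2 * m + 1)
            = C * 2 ^ (2 * m + 1) * (1 + ‖z‖) ^ (2 * m - 1) := by ring
          _ ≤ (1 + ‖z‖) * (1 + ‖z‖) ^ (2 * m - 1) := by gcongr
          _ = _ := by rw [← pow_succ', Nat.sub_add_cancel (by omega)]
      rw [div_le_div_iff₀ (by positivity) (by positivity), one_mul, heval]
      have h5 := hC z
      have h6 : (z.1 ^ 2 + z.2 ^ 2) ^ m - |evalXT G z.1 z.2| ≤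
          |(z.1 ^ 2 + z.2 ^ 2) ^ m + evalXT G z.1 z.2| :=
        le_trans (by linarith [neg_abs_le (evalXT G z.1 z.2)]) (le_abs_self _)
      have h7 : |evalXT G z.1 z.2| * 2 ^ (2 * m + 1) ≤ (1 + ‖z‖) ^ (2 * m) :=
        (mul_le_mul_of_nonneg_right h5 (by positivity)).trans h4
      have h8 := mul_le_mul_of_nonneg_right h6 (by positivity : (0 : ℝ) ≤ 2 ^ (2 * m + 1))
      rw [pow_succ' 2] at h7 h8 ⊢
      nlinarith

/-! ### Leading behaviour of the logarithmic gradient -/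

theorem sq_add_sq_totalDegree_le :
    (MvPolynomial.X 0 ^ 2 + MvPolynomial.X 1 ^ 2 : MvPolynomial (Fin 2) ℝ).totalDegree ≤ 2 := by
  refine (MvPolynomial.totalDegree_add _ _).trans (max_le ?_ ?_) <;> simp

theorem totalDegree_le_of_eq_add {m : ℕ} {G : MvPolynomial (Fin 2) ℝ}
    (hG : G.totalDegree < 2 * m)
    (hFG : F = (MvPolynomial.X 0 ^ 2 + MvPolynomial.X 1 ^ 2) ^ m + G) :
    F.totalDegree ≤ 2 * m := by
  rw [hFG]
  refine (MvPolynomial.totalDegree_add _ _).trans (max_le ?_ hG.le)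
  refine (MvPolynomial.totalDegree_pow _ _).trans ?_
  rw [mul_comm 2]
  exact Nat.mul_le_mul_left _ sq_add_sq_totalDegree_le

/-- `2 ∂ᵢF / F` agrees with `4 m xᵢ / (x² + t²)` up to a bounded multiple of `1 / (x² + t²)`. -/
theorem exists_abs_logDeriv₂_sub_le {m : ℕ} {G : MvPolynomial (Fin 2) ℝ}
    (hG : G.totalDegree < 2 * m)
    (hFG : F = (MvPolynomial.X 0 ^ 2 + MvPolynomial.X 1 ^ 2) ^ m + G)
    (hF : ∀ x t, evalXT F x t ≠ 0) (i : Fin 2) :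
    ∃ C, ∀ z : ℝ × ℝ, z.1 ^ 2 + z.2 ^ 2 ≠ 0 →
      |ratEval F (logDeriv₂ F i) z - 4 * m * (![z.1, z.2] i / (z.1 ^ 2 + z.2 ^ 2))| *
        (z.1 ^ 2 + z.2 ^ 2) ≤ C := by
  obtain ⟨c, hc, hb⟩ := exists_mul_one_add_norm_pow_le hG hFG hF
  -- The numerator of the difference after multiplication by (x² + t²) F. The contributions of (x² +
  -- t²)^m cancel, leaving only terms in G, of degree at most 2m; thus p / F is bounded.
  set p : MvPolynomial (Fin 2) ℝ :=
    MvPolynomial.C 2 * (MvPolynomial.pderiv i G * (MvPolynomial.X 0 ^ 2 + MvPolynomial.X 1 ^ 2)) -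
      MvPolynomial.C (4 * m : ℝ) * (MvPolynomial.X i * G) with hp
  have hdeg : p.totalDegree ≤ 2 * m := by
    refine (MvPolynomial.totalDegree_sub _ _).trans (max_le ?_ ?_)
    · refine (MvPolynomial.totalDegree_mul _ _).trans ?_
      rw [MvPolynomial.totalDegree_C, zero_add]
      rcases Nat.eq_zero_or_pos G.totalDegree with h | h
      · simp [MvPolynomial.pderiv_eq_zero_of_totalDegree_eq_zero i h]
      · have h1 := MvPolynomial.totalDegree_mul (MvPolynomial.pderiv i G)
          (MvPolynomial.X 0 ^ 2 + MvPolynomial.X 1 ^ 2)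
        have h2 := MvPolynomial.totalDegree_pderiv_le i G
        have h3 := sq_add_sq_totalDegree_le
        omega
    · refine (MvPolynomial.totalDegree_mul _ _).trans ?_
      rw [MvPolynomial.totalDegree_C, zero_add]
      have h1 := MvPolynomial.totalDegree_mul (MvPolynomial.X i) G
      rw [MvPolynomial.totalDegree_X] at h1
      omega
  obtain ⟨C, hC⟩ := RatOrder.decays (N := 2 * m) (d := 0) (q := (p, 1))
    (by simpa [RatOrder] using hdeg) hc hb
  refine ⟨C, fun z hz => ?_⟩
  have hpos : 0 < z.1 ^ 2 + z.2 ^ 2 := lt_of_le_of_ne (by positivity) hz.symm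
  have hne := hF z.1 z.2
  have key : (ratEval F (logDeriv₂ F i) z - 4 * m * (![z.1, z.2] i / (z.1 ^ 2 + z.2 ^ 2))) *
      (z.1 ^ 2 + z.2 ^ 2) = ratEval F (p, 1) z := by
    obtain ⟨k, rfl⟩ : ∃ k, m = k + 1 := ⟨m - 1, by omega⟩
    simp only [ratEval, logDeriv₂, pow_one]
    rw [sub_mul, mul_assoc, div_mul_cancel₀ _ hz, div_mul_eq_mul_div, sub_eq_iff_eq_add,
      ← mul_div_cancel_right₀ (4 * ((k + 1 : ℕ) : ℝ) * ![z.1, z.2] i) hne, ← add_div]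
    congr 1
    have hd : evalXT (MvPolynomial.pderiv i F) z.1 z.2 = (k + 1) * (z.1 ^ 2 + z.2 ^ 2) ^ k *
        (2 * ![z.1, z.2] i) + evalXT (MvPolynomial.pderiv i G) z.1 z.2 := by
      rw [hFG]
      fin_cases i <;> simp [evalXT, MvPolynomial.pderiv_X] <;> ring
    have he : evalXT F z.1 z.2 = (z.1 ^ 2 + z.2 ^ 2) ^ (k + 1) + evalXT G z.1 z.2 := by
      simp [hFG, evalXT]
    simp only [hp, evalXT, map_sub, map_mul, MvPolynomial.eval_C, map_add, map_pow,
      MvPolynomial.eval_X] at hd he ⊢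
    rw [hd, he, pow_succ _ k]
    push_cast
    change 2 * _ * _ = 2 * (_ * (z.1 ^ 2 + z.2 ^ 2)) - _ + _
    ring
  rw [← abs_of_pos hpos, ← abs_mul, abs_of_pos hpos, key]
  simpa using hC z

/-! ### The two integral identities -/

/-- The sides have length 2R, so fields of size O(R⁻²) on them have flux O(1/R). -/
theorem Decays.tendsto_boundary_integral {P Q : ℝ × ℝ → ℝ} (hP : Decays 2 P) (hQ : Decays 2 Q) :
    Tendsto (fun R : ℝ => (∫ t in (-R)..R, (P (R, t) - P (-R, t))) +
      ∫ x in (-R)..R, (Q (x, R) - Q (x, -R))) atTop (𝓝 0) := by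
  have key : ∀ f : ℝ × ℝ → ℝ, ∀ C, (∀ z, |f z| * (1 + ‖z‖) ^ 2 ≤ C) → ∀ z z' : ℝ × ℝ, ∀ R : ℝ,
      0 ≤ R → R ≤ ‖z‖ → R ≤ ‖z'‖ → |f z - f z'| * R ^ 2 ≤ C + C := by
    intro f C h z z' R hR h1 h2
    have aux : ∀ z, R ≤ ‖z‖ → |f z| * R ^ 2 ≤ C := fun z hz =>
      le_trans (by gcongr; linarith) (h z)
    calc |f z - f z'| * R ^ 2 ≤ (|f z| + |f z'|) * R ^ 2 := by gcongr; exact abs_sub _ _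
      _ ≤ C + C := by linarith [aux z h1, aux z' h2]
  obtain ⟨A, hA⟩ := hP
  obtain ⟨B, hB⟩ := hQ
  rw [← add_zero (0 : ℝ)]
  refine (tendsto_integral_zero_of_abs_mul_sq_le (C := A + A) fun R s hR _ => ?_).add
    (tendsto_integral_zero_of_abs_mul_sq_le (C := B + B) fun R s hR _ => ?_)
  · refine key P A hA _ _ R (by linarith) ((le_abs_self R).trans (norm_fst_le (R, s))) ?_
    exact ((neg_neg R).symm.le.trans (neg_le_abs (-R))).trans (norm_fst_le (-R, s))
  · refine key Q B hB _ _ R (by linarith) ((le_abs_self R).trans (norm_snd_le (s, R))) ?_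
    exact ((neg_neg R).symm.le.trans (neg_le_abs (-R))).trans (norm_snd_le (s, -R))

/-- For the potential Boussinesq equation
`a_tt + a_xx - (a_x ^ 2)_x - a_xxxx / 3 = 0`, the scaling multiplier `-a + 4 t a_t + 2 x a_x`
writes `a_x ^ 3 - 2 a_x ^ 2` as a divergence. -/
theorem integral_cube_sub_two_mul_sq_eq_zero
    {a ax at' axx axt att axxx axxt axxxx : ℝ × ℝ → ℝ}
    (ha : ∀ x t, HasDerivAt (fun y => a (y, t)) (ax (x, t)) x)
    (hax : ∀ x t, HasDerivAt (fun y => ax (y, t)) (axx (x, t)) x)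
    (haxx : ∀ x t, HasDerivAt (fun y => axx (y, t)) (axxx (x, t)) x)
    (haxxx : ∀ x t, HasDerivAt (fun y => axxx (y, t)) (axxxx (x, t)) x)
    (hat : ∀ x t, HasDerivAt (fun y => at' (y, t)) (axt (x, t)) x)
    (haxt : ∀ x t, HasDerivAt (fun y => axt (y, t)) (axxt (x, t)) x)
    (ha' : ∀ x t, HasDerivAt (fun s => a (x, s)) (at' (x, t)) t)
    (hax' : ∀ x t, HasDerivAt (fun s => ax (x, s)) (axt (x, t)) t)
    (hat' : ∀ x t, HasDerivAt (fun s => at' (x, s)) (att (x, t)) t)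
    (haxx' : ∀ x t, HasDerivAt (fun s => axx (x, s)) (axxt (x, t)) t)
    (ca : Continuous a) (cax : Continuous ax) (cat : Continuous at') (caxx : Continuous axx)
    (caxt : Continuous axt) (catt : Continuous att) (caxxx : Continuous axxx)
    (caxxt : Continuous axxt) (caxxxx : Continuous axxxx)
    (da : Decays 1 a) (dax : Decays 2 ax) (dat : Decays 2 at') (daxx : Decays 3 axx)
    (daxt : Decays 3 axt) (daxxx : Decays 4 axxx)
    (hE : ∀ z, att z + axx z - 2 * ax z * axx z - 1 / 3 * axxxx z = 0) :
    ∫ z, (ax z ^ 3 - 2 * ax z ^ 2) = 0 := by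
  have hint : Integrable fun z => ax z ^ 3 - 2 * ax z ^ 2 :=
    (((dax.pow 3).mono (by norm_num : 4 ≤ 3 * 2)).sub ((dax.pow 2).const_mul 2)).integrable
      (by norm_num) (by fun_prop)
  -- With E the left side of the equation, `K` and `H` come from the energy law aₜ E = ∂ₓ K + ∂ₜ (H
  -- / 4), and `M` from the momentum law 2 aₓ E = ∂ₓ M + ∂ₜ (2 aₓ aₜ). The weights 4t, 2x and -1 are
  -- balanced so that the integrals of aₜ² and a_xx² drop out.
  let K : ℝ × ℝ → ℝ := fun z =>
    at' z * ax z - at' z * ax z ^ 2 - 1 / 3 * (at' z * axxx z - axt z * axx z)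
  let M : ℝ × ℝ → ℝ := fun z =>
    ax z ^ 2 - at' z ^ 2 - 4 / 3 * ax z ^ 3 - 2 / 3 * (ax z * axxx z) + 1 / 3 * axx z ^ 2
  let H : ℝ × ℝ → ℝ := fun z =>
    2 * at' z ^ 2 - 2 * ax z ^ 2 + 4 / 3 * ax z ^ 3 - 2 / 3 * axx z ^ 2
  let P : ℝ × ℝ → ℝ := fun z =>
    a z * ax z ^ 2 - a z * ax z + 1 / 3 * (a z * axxx z) + 1 / 3 * (ax z * axx z) +
      4 * (z.2 * K z) + z.1 * M z
  let Q : ℝ × ℝ → ℝ := fun z =>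
    z.2 * H z - a z * at' z + 2 * (z.1 * (ax z * at' z))
  let K' : ℝ × ℝ → ℝ := fun z =>
    axt z * ax z + at' z * axx z - (axt z * ax z ^ 2 + at' z * (2 * ax z * axx z)) -
      1 / 3 * (at' z * axxxx z - axxt z * axx z)
  let M' : ℝ × ℝ → ℝ := fun z =>
    2 * ax z * axx z - 2 * at' z * axt z - 4 * ax z ^ 2 * axx z - 2 / 3 * (ax z * axxxx z)
  let H' : ℝ × ℝ → ℝ := fun z =>
    4 * at' z * att z - 4 * ax z * axt z + 4 * ax z ^ 2 * axt z - 4 / 3 * (axx z * axxt z)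
  let P' : ℝ × ℝ → ℝ := fun z =>
    ax z * ax z ^ 2 + a z * (2 * ax z * axx z) - (ax z ^ 2 + a z * axx z) +
      1 / 3 * (ax z * axxx z + a z * axxxx z) + 1 / 3 * (axx z ^ 2 + ax z * axxx z) +
      4 * (z.2 * K' z) + (M z + z.1 * M' z)
  let Q' : ℝ × ℝ → ℝ := fun z =>
    H z + z.2 * H' z - (at' z ^ 2 + a z * att z) + 2 * (z.1 * (axt z * at' z + ax z * att z))
  have hPd : ∀ x t, HasDerivAt (fun y => P (y, t)) (P' (x, t)) x := by
    intro x t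
    have hK : HasDerivAt (fun y => K (y, t)) (K' (x, t)) x :=
      ((((hat x t).fun_mul (hax x t)).fun_sub ((hat x t).fun_mul ((hax x t).fun_pow 2))).fun_sub
        ((((hat x t).fun_mul (haxxx x t)).fun_sub ((haxt x t).fun_mul (haxx x t))).const_mul
          (1 / 3))).congr_deriv (by simp only [K']; push_cast; ring)
    have hM : HasDerivAt (fun y => M (y, t)) (M' (x, t)) x :=
      ((((((hax x t).fun_pow 2).fun_sub ((hat x t).fun_pow 2)).fun_sub
        (((hax x t).fun_pow 3).const_mul (4 / 3))).fun_sub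
        (((hax x t).fun_mul (haxxx x t)).const_mul (2 / 3))).fun_add
        (((haxx x t).fun_pow 2).const_mul (1 / 3))).congr_deriv
          (by simp only [M']; push_cast; ring)
    exact (((((((ha x t).fun_mul ((hax x t).fun_pow 2)).fun_sub
      ((ha x t).fun_mul (hax x t))).fun_add
      (((ha x t).fun_mul (haxxx x t)).const_mul (1 / 3))).fun_add
      (((hax x t).fun_mul (haxx x t)).const_mul (1 / 3))).fun_add
      ((hK.const_mul t).const_mul 4)).fun_add
      ((hasDerivAt_id' x).fun_mul hM)).congr_deriv (by simp only [P']; push_cast; ring)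
  have hQd : ∀ x t, HasDerivAt (fun s => Q (x, s)) (Q' (x, t)) t := by
    intro x t
    have hH : HasDerivAt (fun s => H (x, s)) (H' (x, t)) t :=
      ((((((hat' x t).fun_pow 2).const_mul 2).fun_sub (((hax' x t).fun_pow 2).const_mul 2)).fun_add
        (((hax' x t).fun_pow 3).const_mul (4 / 3))).fun_sub
        (((haxx' x t).fun_pow 2).const_mul (2 / 3))).congr_deriv
          (by simp only [H']; push_cast; ring)
    exact ((((hasDerivAt_id' t).fun_mul hH).fun_sub ((ha' x t).fun_mul (hat' x t))).fun_add
      ((((hax' x t).fun_mul (hat' x t)).const_mul x).const_mul 2)).congr_deriv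
        (by simp only [Q']; ring)
  have hsum : ∀ z, P' z + Q' z = ax z ^ 3 - 2 * ax z ^ 2 := by
    intro z
    simp only [P', Q', K', M', M, H, H']
    linear_combination (-a z + 4 * z.2 * at' z + 2 * z.1 * ax z) * hE z
  have hKdec : Decays 3 K :=
    (((dat.mul dax).sub ((dat.mul (dax.pow 2)).mono (by norm_num))).sub
      ((((dat.mul daxxx).mono (by norm_num : 4 ≤ 2 + 4)).sub
        ((daxt.mul daxx).mono (by norm_num))).const_mul (1 / 3))).mono (by norm_num)
  have hMdec : Decays 3 M :=
    (((((dax.pow 2).sub (dat.pow 2)).sub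
      (((dax.pow 3).mono (by norm_num)).const_mul (4 / 3))).sub
      (((dax.mul daxxx).mono (by norm_num)).const_mul (2 / 3))).add
      (((daxx.pow 2).mono (by norm_num)).const_mul (1 / 3))).mono (by norm_num)
  have hHdec : Decays 3 H :=
    (((((dat.pow 2).const_mul 2).sub ((dax.pow 2).const_mul 2)).add
      (((dax.pow 3).mono (by norm_num)).const_mul (4 / 3))).sub
      (((daxx.pow 2).mono (by norm_num)).const_mul (2 / 3))).mono (by norm_num)
  have hPdec : Decays 2 P :=
    ((((((da.mul (dax.pow 2)).mono (by norm_num)).sub ((da.mul dax).mono (by norm_num))).add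
      (((da.mul daxxx).mono (by norm_num)).const_mul (1 / 3))).add
      (((dax.mul daxx).mono (by norm_num)).const_mul (1 / 3))).add
      (hKdec.snd_mul.const_mul 4)).add hMdec.fst_mul
  have hQdec : Decays 2 Q :=
    (hHdec.snd_mul.sub ((da.mul dat).mono (by norm_num))).add
      (((dax.mul dat).mono (by norm_num : 3 ≤ 2 + 2)).fst_mul.const_mul 2)
  have h := integral_divergence_eq_of_tendsto hPd hQd (by fun_prop) (by fun_prop)
    (by simpa only [hsum] using hint) (hPdec.tendsto_boundary_integral hQdec)
  simpa only [hsum] using h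

/-- The model κ R / (R² + s²) has the same integral for every R > 0, and the error is O(R⁻²) on a
side of length 2R. -/
theorem tendsto_integral_side {f : ℝ → ℝ → ℝ} (hc : ∀ R, Continuous (f R)) {κ C : ℝ}
    (h : ∀ R s, 1 ≤ R → |s| ≤ R → |f R s - κ * (R / (R ^ 2 + s ^ 2))| * R ^ 2 ≤ C) :
    Tendsto (fun R : ℝ => ∫ s in (-R)..R, f R s) atTop (𝓝 (κ * (Real.pi / 2))) := by
  have h0 := (tendsto_integral_zero_of_abs_mul_sq_le h).add_const (κ * (Real.pi / 2))
  rw [zero_add] at h0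
  refine h0.congr' ?_
  filter_upwards [eventually_gt_atTop 0] with R hR
  have hcR : Continuous fun s : ℝ => κ * (R / (R ^ 2 + s ^ 2)) :=
    continuous_const.mul (continuous_const.div (by fun_prop) fun s => by positivity)
  rw [intervalIntegral.integral_sub ((hc R).intervalIntegrable _ _) (hcR.intervalIntegrable _ _),
    intervalIntegral.integral_const_mul, integral_div_sq_add_sq_self hR, sub_add_cancel]

theorem tendsto_boundary_integral_logDeriv₂ {m : ℕ} {G : MvPolynomial (Fin 2) ℝ}
    (hG : G.totalDegree < 2 * m)
    (hFG : F = (MvPolynomial.X 0 ^ 2 + MvPolynomial.X 1 ^ 2) ^ m + G)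
    (hF : ∀ x t, evalXT F x t ≠ 0) :
    Tendsto (fun R : ℝ =>
      (∫ t in (-R)..R, (ratEval F (logDeriv₂ F 0) (R, t) - ratEval F (logDeriv₂ F 0) (-R, t))) +
      ∫ x in (-R)..R, (ratEval F (logDeriv₂ F 1) (x, R) - ratEval F (logDeriv₂ F 1) (x, -R)))
      atTop (𝓝 (8 * m * Real.pi)) := by
  -- The leading field is odd, so opposite sides reinforce each other: d is its value on one side,
  -- -d on the other, and S = R² + s².
  have key : ∀ b c d : ℝ, ∀ S R C : ℝ, 0 < R → R ^ 2 ≤ S → |b - d| * S ≤ C →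
      |c - -d| * S ≤ C → |b - c - 2 * d| * R ^ 2 ≤ C + C := by
    intro b c d S R C hR hS h1 h2
    have h3 : |b - c - 2 * d| ≤ |b - d| + |c - -d| := by
      rw [show b - c - 2 * d = (b - d) - (c - -d) by ring]
      exact abs_sub _ _
    calc |b - c - 2 * d| * R ^ 2 ≤ (|b - d| + |c - -d|) * S := by gcongr
      _ ≤ C + C := by linarith
  rw [show 8 * m * Real.pi = 2 * (4 * m) * (Real.pi / 2) + 2 * (4 * m) * (Real.pi / 2) by ring]
  have hc := fun i => continuous_ratEval hF (logDeriv₂ F i)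
  obtain ⟨A, hA⟩ := exists_abs_logDeriv₂_sub_le hG hFG hF 0
  obtain ⟨B, hB⟩ := exists_abs_logDeriv₂_sub_le hG hFG hF 1
  refine (tendsto_integral_side (C := A + A) (fun R => ?_) fun R s hR _ => ?_).add
    (tendsto_integral_side (C := B + B) (fun R => ?_) fun R s hR _ => ?_)
  · exact ((hc 0).comp (by fun_prop : Continuous fun t : ℝ => (R, t))).sub
      ((hc 0).comp (by fun_prop : Continuous fun t : ℝ => (-R, t)))
  · have h1 := hA (R, s) (by dsimp only; positivity)
    have h2 := hA (-R, s) (by dsimp only; rw [neg_sq]; positivity)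
    simp only [Matrix.cons_val_zero, neg_sq, neg_div, mul_neg] at h1 h2
    rw [mul_assoc 2]
    exact key _ _ _ _ R A (by linarith) (by nlinarith) h1 h2
  · exact ((hc 1).comp (by fun_prop : Continuous fun x : ℝ => (x, R))).sub
      ((hc 1).comp (by fun_prop : Continuous fun x : ℝ => (x, -R)))
  · have h1 := hB (s, R) (by dsimp only; positivity)
    have h2 := hB (s, -R) (by dsimp only; rw [neg_sq]; positivity)
    simp only [Matrix.cons_val_one, Matrix.cons_val_fin_one, neg_sq, neg_div, mul_neg] at h1 h2
    rw [mul_assoc 2, add_comm (R ^ 2)]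
    exact key _ _ _ _ R B (by linarith) (by nlinarith) h1 h2

/-! ### Integrating the Boussinesq equation -/

theorem iteratedDeriv_ratEval_fst (hF : ∀ x t, evalXT F x t ≠ 0)
    (q : MvPolynomial (Fin 2) ℝ × ℕ) (t : ℝ) (k : ℕ) :
    iteratedDeriv k (fun y => ratEval F q (y, t)) =
      fun y => ratEval F ((ratDeriv F 0)^[k] q) (y, t) := by
  induction k with
  | zero => simp
  | succ k ih =>
    rw [iteratedDeriv_succ, ih, Function.iterate_succ_apply']
    exact funext fun y => (hasDerivAt_ratEval_fst hF _ y t).deriv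

theorem iteratedDeriv_ratEval_snd (hF : ∀ x t, evalXT F x t ≠ 0)
    (q : MvPolynomial (Fin 2) ℝ × ℕ) (x : ℝ) (k : ℕ) :
    iteratedDeriv k (fun s => ratEval F q (x, s)) =
      fun s => ratEval F ((ratDeriv F 1)^[k] q) (x, s) := by
  induction k with
  | zero => simp
  | succ k ih =>
    rw [iteratedDeriv_succ, ih, Function.iterate_succ_apply']
    exact funext fun s => (hasDerivAt_ratEval_snd hF _ x s).deriv

theorem iteratedDeriv_two_ratEval_sq (hF : ∀ x t, evalXT F x t ≠ 0)
    (q : MvPolynomial (Fin 2) ℝ × ℕ) (x t : ℝ) :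
    iteratedDeriv 2 (fun y => ratEval F q (y, t) ^ 2) x =
      2 * (ratEval F (ratDeriv F 0 q) (x, t) * ratEval F (ratDeriv F 0 q) (x, t) +
        ratEval F q (x, t) * ratEval F (ratDeriv F 0 (ratDeriv F 0 q)) (x, t)) := by
  have h1 : deriv (fun y => ratEval F q (y, t) ^ 2) =
      fun y => 2 * (ratEval F q (y, t) * ratEval F (ratDeriv F 0 q) (y, t)) := funext fun y => by
    rw [((hasDerivAt_ratEval_fst hF q y t).fun_pow 2).deriv]
    push_cast
    ring
  rw [iteratedDeriv_succ, iteratedDeriv_one, h1]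
  exact (((hasDerivAt_ratEval_fst hF q x t).fun_mul
    (hasDerivAt_ratEval_fst hF (ratDeriv F 0 q) x t)).const_mul 2).deriv

theorem twoLogXX_eq_ratEval (hF : ∀ x t, evalXT F x t ≠ 0) (x t : ℝ) :
    twoLogXX F x t = ratEval F (ratDeriv F 0 (logDeriv₂ F 0)) (x, t) := by
  have h1 : deriv (fun y => Real.log (evalXT F y t)) =
      fun y => 1 / 2 * ratEval F (logDeriv₂ F 0) (y, t) := funext fun y => by
    rw [((hasDerivAt_evalXT_fst F y t).log (hF y t)).deriv]
    simp [ratEval, logDeriv₂, evalXT]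
    ring
  rw [twoLogXX, iteratedDeriv_succ, iteratedDeriv_one, h1,
    ((hasDerivAt_ratEval_fst hF (logDeriv₂ F 0) x t).const_mul (1 / 2)).deriv]
  ring

/-- Let `f` be a family of functions closed under the partial derivatives `X`, `T`, graded by their
decay at infinity, and let `(f φ, f ψ)` be a gradient field of order `1` such that `f (X φ)` solves
the Boussinesq equation. If the flux of `(f φ, f ψ)` through large squares tends to `L`, then
`∫ f (X φ) ^ 2 = L` and `∫ f (X φ) ^ 3 = 2 L`. -/
theorem integral_sq_and_cube_of_boussinesq {ι : Type*} (f : ι → ℝ × ℝ → ℝ) (X T : ι → ι)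
    (ord : ℕ → ι → Prop) {φ ψ : ι} {L : ℝ}
    (cont : ∀ q, Continuous (f q))
    (dX : ∀ q x t, HasDerivAt (fun y => f q (y, t)) (f (X q) (x, t)) x)
    (dT : ∀ q x t, HasDerivAt (fun s => f q (x, s)) (f (T q) (x, t)) t)
    (hcomm : ∀ q, T (X q) = X (T q)) (hψφ : X ψ = T φ)
    (dec : ∀ {d q}, ord d q → Decays d (f q))
    (oX : ∀ {d q}, ord d q → ord (d + 1) (X q)) (oT : ∀ {d q}, ord d q → ord (d + 1) (T q))
    (oφ : ord 1 φ) (oψ : ord 1 ψ)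
    (hB : ∀ z, f (X (T (T φ))) z + f (X (X (X φ))) z -
      2 * (f (X (X φ)) z * f (X (X φ)) z + f (X φ) z * f (X (X (X φ))) z) -
      1 / 3 * f (X (X (X (X (X φ))))) z = 0)
    (hlim : Tendsto (fun R : ℝ => (∫ t in (-R)..R, (f φ (R, t) - f φ (-R, t))) +
      ∫ x in (-R)..R, (f ψ (x, R) - f ψ (x, -R))) atTop (𝓝 L)) :
    (Integrable (fun z => f (X φ) z ^ 2) ∧ ∫ z, f (X φ) z ^ 2 = L) ∧
      (Integrable (fun z => f (X φ) z ^ 3) ∧ ∫ z, f (X φ) z ^ 3 = 2 * L) := by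
  -- `hB` says that the x-derivative of this expression vanishes, and the expression decays.
  have hE : ∀ z, f (T (T φ)) z + f (X (X φ)) z - 2 * f (X φ) z * f (X (X φ)) z -
      1 / 3 * f (X (X (X (X φ)))) z = 0 := by
    refine Decays.eq_zero_of_hasDerivAt_fst ?_ fun x t => ?_
    · exact ((((dec (oT (oT oφ))).add (dec (oX (oX oφ)))).sub
        ((((dec (oX oφ)).const_mul 2).mul (dec (oX (oX oφ)))).mono (by norm_num))).sub
        (((dec (oX (oX (oX (oX oφ))))).mono (by norm_num)).const_mul (1 / 3))).mono (by norm_num)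
    · refine ((((dX _ x t).fun_add (dX _ x t)).fun_sub
        (((dX _ x t).const_mul 2).fun_mul (dX _ x t))).fun_sub
        ((dX _ x t).const_mul (1 / 3))).congr_deriv ?_
      linear_combination hB (x, t)
  -- The same argument once more: since `X ψ = T φ`, the second t-derivative of φ is an
  -- x-derivative, namely that of `T ψ`.
  have hE₂ : ∀ z, f (T ψ) z + f (X φ) z - f (X φ) z ^ 2 - 1 / 3 * f (X (X (X φ))) z = 0 := by
    refine Decays.eq_zero_of_hasDerivAt_fst ?_ fun x t => ?_
    · exact ((((dec (oT oψ)).add (dec (oX oφ))).sub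
        (((dec (oX oφ)).pow 2).mono (by norm_num))).sub
        (((dec (oX (oX (oX oφ)))).mono (by norm_num)).const_mul (1 / 3))).mono (by norm_num)
    · refine ((((dX _ x t).fun_add (dX _ x t)).fun_sub ((dX _ x t).fun_pow 2)).fun_sub
        ((dX _ x t).const_mul (1 / 3))).congr_deriv ?_
      rw [← hcomm, hψφ]
      push_cast
      linear_combination hE (x, t)
  have int2 : Integrable fun z => f (X φ) z ^ 2 :=
    ((dec (oX oφ)).pow 2).integrable (by norm_num) ((cont _).pow 2)
  have int3 : Integrable fun z => f (X φ) z ^ 3 :=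
    ((dec (oX oφ)).pow 3).integrable (by norm_num) ((cont _).pow 3)
  have val2 : ∫ z, f (X φ) z ^ 2 = L := by
    have hsum : (fun z => (f (X φ) z - 1 / 3 * f (X (X (X φ))) z) + f (T ψ) z) =
        fun z => f (X φ) z ^ 2 := funext fun z => by linear_combination hE₂ z
    -- The dispersive correction `X (X φ)` has order 3, so its flux vanishes in the limit and `L` is
    -- unchanged.
    have hlim' : Tendsto (fun R : ℝ => (∫ t in (-R)..R,
        ((f φ (R, t) - 1 / 3 * f (X (X φ)) (R, t)) -
          (f φ (-R, t) - 1 / 3 * f (X (X φ)) (-R, t)))) +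
        ∫ x in (-R)..R, (f ψ (x, R) - f ψ (x, -R))) atTop (𝓝 L) := by
      have h2 := Decays.tendsto_boundary_integral
        (((dec (oX (oX oφ))).const_mul (1 / 3)).mono (by norm_num))
        (show Decays 2 fun _ => 0 from ⟨0, by simp⟩)
      have h3 := hlim.sub h2
      rw [sub_zero L] at h3
      refine h3.congr fun R => ?_
      have hci : ∀ q r, Continuous fun t : ℝ => f q (r, t) := fun q r =>
        (cont q).comp (by fun_prop)
      simp only [sub_self, intervalIntegral.integral_zero, add_zero]
      rw [add_sub_right_comm, ← intervalIntegral.integral_sub]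
      · congr 2
        funext t
        ring
      · exact ((hci _ _).sub (hci _ _)).intervalIntegrable _ _
      · exact (((hci _ _).const_mul _).sub ((hci _ _).const_mul _)).intervalIntegrable _ _
    rw [← hsum] at int2 ⊢
    exact integral_divergence_eq_of_tendsto
      (P := fun z => f φ z - 1 / 3 * f (X (X φ)) z) (Q := f ψ)
      (P' := fun z => f (X φ) z - 1 / 3 * f (X (X (X φ))) z)
      (fun x t => (dX _ x t).fun_sub ((dX _ x t).const_mul (1 / 3))) (dT ψ)
      ((cont _).sub ((cont _).const_mul _)) (cont _) int2 hlim'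
  refine ⟨⟨int2, val2⟩, int3, ?_⟩
  have h := integral_cube_sub_two_mul_sq_eq_zero (dX φ) (dX _) (dX _) (dX _) (dX _) (dX _)
    (dT φ) (by simpa only [hcomm] using dT (X φ)) (dT _)
    (by simpa only [hcomm] using dT (X (X φ))) (cont _) (cont _) (cont _) (cont _) (cont _)
    (cont _) (cont _) (cont _) (cont _) (dec oφ) (dec (oX oφ)) (dec (oT oφ))
    (dec (oX (oX oφ))) (dec (oX (oT oφ))) (dec (oX (oX (oX oφ)))) hE
  rw [integral_sub int3 (int2.const_mul 2), integral_const_mul, val2] at h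
  linarith

theorem theorem1 (n : ℕ) (hn : 1 ≤ n) (F G : MvPolynomial (Fin 2) ℝ)
    (hG : G.totalDegree < n * (n + 1))
    (hF : F = (MvPolynomial.X 0 ^ 2 + MvPolynomial.X 1 ^ 2) ^ (n * (n + 1) / 2) + G)
    (hzero : ∀ x t : ℝ, evalXT F x t ≠ 0)
    (u : ℝ → ℝ → ℝ) (hu : ∀ x t : ℝ, u x t = twoLogXX F x t)
    (hsol : IsBoussinesqSolution u) :
    (Integrable (fun p : ℝ × ℝ => u p.1 p.2 ^ 2) ∧
      1 / (8 * Real.pi) * ∫ t : ℝ, ∫ x : ℝ, u x t ^ 2 = (n : ℝ) * (n + 1) / 2) ∧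
    (Integrable (fun p : ℝ × ℝ => u p.1 p.2 ^ 3) ∧
      1 / (8 * Real.pi) * ∫ t : ℝ, ∫ x : ℝ, u x t ^ 3 = (n : ℝ) * (n + 1)) := by
  -- Evenness of n(n+1) makes the natural-number division in the exponent exact.
  obtain ⟨m, hm⟩ : ∃ m, n * (n + 1) = 2 * m :=
    (Nat.even_mul_succ_self n).exists_two_nsmul.imp fun m h => by simpa using h
  have hmn : (n : ℝ) * (n + 1) = 2 * m := by exact_mod_cast hm
  rw [hm, Nat.mul_div_cancel_left _ two_pos] at hF
  rw [hm] at hG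
  have hN : 1 ≤ 2 * m := by omega
  have hdeg := totalDegree_le_of_eq_add hG hF
  obtain ⟨c, hc, hb⟩ := exists_mul_one_add_norm_pow_le hG hF hzero
  have hu' : ∀ x t, u x t = ratEval F (ratDeriv F 0 (logDeriv₂ F 0)) (x, t) := fun x t =>
    (hu x t).trans (twoLogXX_eq_ratEval hzero x t)
  have h2 {α : Type} (g : α → α) (q : α) : g^[2] q = g (g q) := rfl
  have h4 {α : Type} (g : α → α) (q : α) : g^[4] q = g (g (g (g q))) := rfl
  obtain ⟨⟨int2, val2⟩, int3, val3⟩ := integral_sq_and_cube_of_boussinesq (ratEval F)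
    (ratDeriv F 0) (ratDeriv F 1) (RatOrder (2 * m)) (continuous_ratEval hzero)
    (hasDerivAt_ratEval_fst hzero) (hasDerivAt_ratEval_snd hzero) (ratDeriv_comm 1 0)
    (ratDeriv_logDeriv₂_comm 0 1) (fun h => h.decays hc hb) (fun h => h.ratDeriv hN hdeg 0)
    (fun h => h.ratDeriv hN hdeg 1) (ratOrder_logDeriv₂ hN hdeg 0) (ratOrder_logDeriv₂ hN hdeg 1)
    (fun z => by
      have h := hsol.2 z.1 z.2
      simp only [hu'] at h
      rw [iteratedDeriv_ratEval_fst hzero, iteratedDeriv_ratEval_fst hzero,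
        iteratedDeriv_ratEval_snd hzero, iteratedDeriv_two_ratEval_sq hzero] at h
      rwa [h4, h2, h2, ratDeriv_comm 1 0, ratDeriv_comm 1 0] at h)
    (tendsto_boundary_integral_logDeriv₂ hG hF hzero)
  have hpi := Real.pi_pos.ne'
  simp only [hu', hmn]
  refine ⟨⟨int2, ?_⟩, int3, ?_⟩
  · rw [← integral_prod_symm _ int2, ← Measure.volume_eq_prod, val2]
    field_simp
  · rw [← integral_prod_symm _ int3, ← Measure.volume_eq_prod, val3]
    field_simp
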